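/- **Theorem (Centralized Approximation).** Let $N\ge 1$ agents be the nodes of a connected undirected simple graph; write $\mathcal N_i$ for the set of neighbours of $i$. Let $\theta\in\mathbb R^n$, $H_i\in\mathbb R^{m_i\times n}$, and let agent $i$ measure $y_i(t)=H_i\theta+v_i(t)$, $t=0,1,2,\dots$. Assume that $G=\sum_{i=1}^N H_i^TH_i$ has full rank and that the stacked noises $V(t)=[v_1(t)^T,\dots,v_N(t)^T]^T$ are i.i.d. in $t$ (possibly correlated between agents) with mean zero and $\mathbb E\|V(t)\|^{2+\epsilon_1}<\infty$ for some $\epsilon_1>0$. Let $\alpha(t)=a/(t+1)^{\tau_1}$ and $\beta(t)=b/(t+1)^{\tau_2}$ with $a,b>0$, $0<\tau_2\le\tau_1\le1$ and $\tau_1>\max\{\tau_2+\frac1{2+\epsilon_1},\frac12\}$. Let $\rho_i>0$ and $\rho_0=\min_i\rho_i$, and assume $\rho_0>\tau_1-\tau_2$. *Event-triggered estimator.* Time $0$ is a triggering time of every agent. For $t\ge1$ let $s_i(t)<t$ be the latest triggering time of agent $i$ before $t$, and set $s_i(0)=0$; $t\ge1$ is a triggering time of agent $i$ if and only if $\|x_i(t)-x_i(s_i(t))\|>(t+1)^{-\rho_i}$.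 For $t\ge 0$ let $\gamma_i(t)=0$ if this inequality holds and $\gamma_i(t)=1$ otherwise. From arbitrary initial values $x_i(0)$ (deterministic or random), $$x_i(t+1)=x_i(t)+\alpha(t)H_i^T\big(y_i(t)-H_ix_i(t)\big)+\beta(t)\sum_{j\in\mathcal N_i}\big(\gamma_j(t)\,x_j(s_j(t))+(1-\gamma_j(t))\,x_j(t)-x_i(t)\big).$$ *Centralized estimator.* From an arbitrary initial value $u(0)$ (deterministic or random), $$u(t+1)=u(t)+\frac{\alpha(t)}{N}\sum_{i=1}^N H_i^T\big(y_i(t)-H_iu(t)\big),$$ with the same step $\alpha(t)=a/(t+1)^{\tau_1}$. Then for every $\tau_0$ with $$0\le\tau_0<\min\Big\{\tau_1-\tau_2-\frac1{2+\epsilon_1},\ \rho_0+\tau_2-\tau_1\Big\}$$ that in addition satisfies $a>N\tau_0/\lambda_{\min}(G)$ in the case $\tau_1=1$, where $\lambda_{\min}(G)$ is the smallest eigenvalue of $G$, $$\mathbb P\Big(\lim_{t\to\infty}(t+1)^{\tau_0}\|x_i(t)-u(t)\|=0\Big)=1\qquad\text{for all } i.$$ -/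

import Mathlib

open MeasureTheory ProbabilityTheory Filter Topology

noncomputable section

namespace EventTriggered

/-- The polynomially decaying sequence `c / (t + 1) ^ τ`, `t = 0, 1, 2, …`. -/
def decay (c τ : ℝ) (t : ℕ) : ℝ := c / ((t : ℝ) + 1) ^ τ

/-- For an agent with threshold exponent `ρ` and estimates `x 0, x 1, …`, the latest triggering
time before `t`. Time `0` is the first triggering time (the initial estimate is sent out), and
`t ≥ 1` is a triggering time when the current estimate `x t` differs by more than `1 / (t + 1) ^ ρ`
from the estimate that was sent out last. -/
def latestTrigger {n : ℕ} (ρ : ℝ) (x : ℕ → EuclideanSpace ℝ (Fin n)) : ℕ → ℕ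
  | 0 => 0
  | t + 1 => if ‖x t - x (latestTrigger ρ x t)‖ > decay 1 ρ t then t else latestTrigger ρ x t

/-- The triggering event at time `t`. -/
def Event {n : ℕ} (ρ : ℝ) (x : ℕ → EuclideanSpace ℝ (Fin n)) (t : ℕ) : Prop :=
  ‖x t - x (latestTrigger ρ x t)‖ > decay 1 ρ t

open Classical in
/-- The indicator `γ(t)`: `0` if the event occurs at time `t` (the estimate is sent), else `1`. -/
def gam {n : ℕ} (ρ : ℝ) (x : ℕ → EuclideanSpace ℝ (Fin n)) (t : ℕ) : ℝ :=
  if Event ρ x t then 0 else 1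

/-- The neighbours' knowledge of an agent at time `t`: the current estimate if it is sent out at
time `t`, otherwise the estimate that was sent out last. -/
def known {n : ℕ} (ρ : ℝ) (x : ℕ → EuclideanSpace ℝ (Fin n)) (t : ℕ) :
    EuclideanSpace ℝ (Fin n) :=
  gam ρ x t • x (latestTrigger ρ x t) + (1 - gam ρ x t) • x t

/-- `known` is the estimate sent out at the latest triggering time up to and including `t`. -/
theorem known_eq {n : ℕ} (ρ : ℝ) (x : ℕ → EuclideanSpace ℝ (Fin n)) (t : ℕ) :
    known ρ x t = x (latestTrigger ρ x (t + 1)) := by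
  by_cases h : ‖x t - x (latestTrigger ρ x t)‖ > decay 1 ρ t <;>
    simp [known, gam, Event, latestTrigger, h]

/-- The innovation `Hᵀ (y - H x)`. -/
def innovation {m n : ℕ} (H : Matrix (Fin m) (Fin n) ℝ) (y : EuclideanSpace ℝ (Fin m))
    (x : EuclideanSpace ℝ (Fin n)) : EuclideanSpace ℝ (Fin n) :=
  Matrix.toEuclideanLin H.transpose (y - Matrix.toEuclideanLin H x)

/-- The event-triggered distributed estimator: `x i t` is the estimate of agent `i` at time `t`,
`y i t` its measurement, `α` and `β` are the step sizes. -/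
def IsDistributedEstimator {N n : ℕ} {m : Fin N → ℕ}
    (Gr : SimpleGraph (Fin N)) [DecidableRel Gr.Adj]
    (H : (i : Fin N) → Matrix (Fin (m i)) (Fin n) ℝ) (ρ : Fin N → ℝ) (α β : ℕ → ℝ)
    (y : (i : Fin N) → ℕ → EuclideanSpace ℝ (Fin (m i)))
    (x : Fin N → ℕ → EuclideanSpace ℝ (Fin n)) : Prop :=
  ∀ i t, x i (t + 1) = x i t + α t • innovation (H i) (y i t) (x i t)
    + β t • ∑ j ∈ Gr.neighborFinset i, (known (ρ j) (x j) t - x i t)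

/-- The centralized linear estimator with step sizes `α`. -/
def IsCentralizedEstimator {N n : ℕ} {m : Fin N → ℕ}
    (H : (i : Fin N) → Matrix (Fin (m i)) (Fin n) ℝ) (α : ℕ → ℝ)
    (y : (i : Fin N) → ℕ → EuclideanSpace ℝ (Fin (m i)))
    (u : ℕ → EuclideanSpace ℝ (Fin n)) : Prop :=
  ∀ t, u (t + 1) = u t + (α t / N) • ∑ i, innovation (H i) (y i t) (u t)

/-- The matrix `G = ∑ᵢ Hᵢᵀ Hᵢ`. -/
def gramSum {N n : ℕ} {m : Fin N → ℕ} (H : (i : Fin N) → Matrix (Fin (m i)) (Fin n) ℝ) :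
    Matrix (Fin n) (Fin n) ℝ :=
  ∑ i, (H i).transpose * H i

/-- The smallest (real) eigenvalue of a matrix. -/
def lambdaMin {n : ℕ} (A : Matrix (Fin n) (Fin n) ℝ) : ℝ := sInf (spectrum ℝ A)

/-- The noises of all agents at time `t`, stacked into one vector with the Euclidean norm. -/
def stack {N : ℕ} {m : Fin N → ℕ} {Ω : Type*}
    (v : (i : Fin N) → ℕ → Ω → EuclideanSpace ℝ (Fin (m i))) (t : ℕ) (ω : Ω) :
    PiLp 2 (fun i => EuclideanSpace ℝ (Fin (m i))) :=
  WithLp.toLp 2 (fun i => v i t ω)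

end EventTriggered

end

open Asymptotics

namespace EventTriggered

/-! The argument is pathwise; probability enters only through noise growth. With `p = 1 / (2 + ε₁)`,
the moment bound and Borel–Cantelli give noises of order `t ^ p` almost surely. The stacked errors
`z i = x i - θ` satisfy `z⁺ = z - (β L + α D) z + α ν + β η`, where `L` is the Laplacian, `D` has
blocks `Hᵢᵀ Hᵢ`, and the triggering error `η` is of order `t ^ (-ρ₀)`.

Each rate comes from one scalar recursion (`isBigO_decay_of_recursion`): contraction of order `t ^
(-τ)` under forcing of order `t ^ (-(τ + q))` yields order `t ^ (-q)`. On the whole space `β L + α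
D` contracts at least like `α`, so `z` is of order `t ^ p` (`isBigO_error`). Orthogonally to
consensus `L` contracts like `β`, so the disagreement is of order `t ^ (-(τ₁ - τ₂ - p))`
(`isBigO_deviation`). The average obeys the centralized recursion with the same averaged noise,
which cancels in the difference; what remains is driven by disagreement and triggering error
(`isBigO_average_sub`). -/

/-! ### Polynomial decay and the scalar recursion -/

theorem decay_nonneg {c : ℝ} (hc : 0 ≤ c) (τ : ℝ) (t : ℕ) : 0 ≤ decay c τ t := by
  unfold decay; positivity

theorem decay_pos {c : ℝ} (hc : 0 < c) (τ : ℝ) (t : ℕ) : 0 < decay c τ t := by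
  unfold decay; positivity

theorem decay_mul (c d τ σ : ℝ) (t : ℕ) :
    decay c τ t * decay d σ t = decay (c * d) (τ + σ) t := by
  have hs : (0 : ℝ) < (t : ℝ) + 1 := by positivity
  simp only [decay, Real.rpow_add hs]
  field_simp

theorem decay_eq_mul (c τ : ℝ) (t : ℕ) : decay c τ t = c * decay 1 τ t := by
  simp only [decay]; ring

theorem decay_anti {τ σ : ℝ} (h : σ ≤ τ) (t : ℕ) : decay 1 τ t ≤ decay 1 σ t := by
  unfold decay
  have : (1 : ℝ) ≤ (t : ℝ) + 1 := by simp
  gcongr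

theorem tendsto_add_one_atTop : Tendsto (fun t : ℕ => (t : ℝ) + 1) atTop atTop :=
  tendsto_atTop_add_const_right _ _ tendsto_natCast_atTop_atTop

theorem tendsto_decay (c : ℝ) {τ : ℝ} (hτ : 0 < τ) : Tendsto (decay c τ) atTop (𝓝 0) :=
  ((tendsto_rpow_atTop hτ).comp tendsto_add_one_atTop).const_div_atTop c

theorem decay_isBigO (c : ℝ) {τ σ : ℝ} (h : σ ≤ τ) : decay c τ =O[atTop] decay 1 σ := by
  refine IsBigO.of_bound |c| (Eventually.of_forall fun t => ?_)
  rw [decay_eq_mul, norm_mul, Real.norm_eq_abs c, Real.norm_of_nonneg (decay_nonneg zero_le_one _ _),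
    Real.norm_of_nonneg (decay_nonneg zero_le_one _ _)]
  gcongr
  exact decay_anti h t

/-- A term of order `(t + 1) ^ (-σ)` weighted by the step `c / (t + 1) ^ τ`. -/
theorem isBigO_decay_smul {X : Type*} [NormedAddCommGroup X] [NormedSpace ℝ X] (c : ℝ)
    {τ σ κ : ℝ} {f : ℕ → X} (hf : f =O[atTop] decay 1 σ) (h : κ ≤ τ + σ) :
    (fun t => decay c τ t • f t) =O[atTop] decay 1 κ := by
  refine ((decay_isBigO c (le_refl τ)).smul hf).trans ?_
  simp only [smul_eq_mul, decay_mul, one_mul]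
  exact decay_isBigO 1 h

/-- Tangent estimate for `(t + 1) ^ (-q)` from one time to the next. -/
theorem decay_succ_ge (q : ℝ) (t : ℕ) :
    (1 - max q 0 / ((t : ℝ) + 1)) * decay 1 q t ≤ decay 1 q (t + 1) := by
  have hs : (0 : ℝ) < (t : ℝ) + 1 := by positivity
  set s : ℝ := (t : ℝ) + 1 with hs_def
  have h1 : decay 1 q t = s ^ (-q) := by
    rw [Real.rpow_neg hs.le]; simp [decay, hs_def]
  have h2 : decay 1 q (t + 1) = (s + 1) ^ (-q) := by
    rw [Real.rpow_neg (by positivity : (0 : ℝ) ≤ s + 1)]; simp [decay, hs_def]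
  rw [h1, h2]
  rcases le_total q 0 with hq | hq
  · rw [max_eq_right hq, zero_div, sub_zero, one_mul]
    exact Real.rpow_le_rpow hs.le (by linarith) (by linarith)
  · rw [max_eq_left hq]
    have h3 : s + 1 = (1 + 1 / s) * s := by field_simp
    have h4 : (0 : ℝ) < 1 + 1 / s := by positivity
    rw [h3, Real.mul_rpow h4.le hs.le]
    gcongr
    rw [Real.rpow_def_of_pos h4]
    -- `exp (-q log (1 + 1/s)) ≥ 1 - q log (1 + 1/s) ≥ 1 - q/s`.
    have h5 := Real.add_one_le_exp (Real.log (1 + 1 / s) * -q)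
    have h6 := Real.log_le_sub_one_of_pos h4
    have h7 : q * Real.log (1 + 1 / s) ≤ q * (1 / s) :=
      mul_le_mul_of_nonneg_left (by linarith) hq
    have h8 : q / s = q * (1 / s) := by ring
    linarith

/-- Decay rate of a nonnegative sequence that contracts with rate `c / (t + 1) ^ τ` under a forcing
term of order `(t + 1) ^ (-(τ + q))`. -/
theorem isBigO_decay_of_recursion {r f : ℕ → ℝ} {c τ q : ℝ} (hr : ∀ t, 0 ≤ r t)
    (hτ0 : 0 < τ) (hτ1 : τ ≤ 1) (hc : 0 < c) (hq : τ = 1 → q < c)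
    (hf : f =O[atTop] decay 1 (τ + q))
    (h : ∀ᶠ t in atTop, r (t + 1) ≤ (1 - decay c τ t) * r t + f t) :
    r =O[atTop] decay 1 q := by
  obtain ⟨C, hC, hfC⟩ := hf.exists_pos
  -- `c'` is the contraction left after paying for the relative drop `q / (t + 1)` of the comparison
  -- sequence. For `τ < 1` that drop is negligible against the step; for `τ = 1` it requires `q <
  -- c`.
  obtain ⟨c', hc', hrate⟩ : ∃ c' > 0, ∀ᶠ t : ℕ in atTop,
      max q 0 / ((t : ℝ) + 1) ≤ decay (c - c') τ t := by
    rcases hτ1.eq_or_lt with h1 | h1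
    · refine ⟨c - max q 0, sub_pos.2 (max_lt (hq h1) hc), Eventually.of_forall fun t => ?_⟩
      simp [decay, h1]
    · refine ⟨c / 2, by positivity, ?_⟩
      have := (tendsto_decay (max q 0) (sub_pos.2 h1)).eventually (ge_mem_nhds (half_pos hc))
      filter_upwards [this] with t ht
      have hs : (0 : ℝ) < (t : ℝ) + 1 := by positivity
      have e : max q 0 / ((t : ℝ) + 1) = decay (max q 0) (1 - τ) t * decay 1 τ t := by
        rw [decay_mul]; simp [decay]
      rw [e, decay_eq_mul (c - c / 2)]
      have := decay_nonneg zero_le_one τ t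
      gcongr
      linarith
  have hsmall := (tendsto_decay c hτ0).eventually (ge_mem_nhds one_pos)
  obtain ⟨T, hT⟩ := eventually_atTop.1 (h.and (hfC.bound.and (hrate.and hsmall)))
  -- The first entry lets the surplus `c'` absorb the forcing, the second starts the induction at
  -- `T`.
  set M := max (C / c') (r T / decay 1 q T)
  have hM : C ≤ M * c' := (div_le_iff₀ hc').1 (le_max_left _ _)
  have hM0 : 0 ≤ M := le_trans (by positivity) (le_max_left _ _)
  have key : ∀ t ≥ T, r t ≤ M * decay 1 q t := by
    intro t ht
    induction t, ht using Nat.le_induction with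
    | base => exact (div_le_iff₀ (decay_pos one_pos _ _)).1 (le_max_right _ _)
    | succ t ht ih =>
      obtain ⟨h1, h2, h3, h4⟩ := hT t ht
      have h5 : f t ≤ C * (decay 1 τ t * decay 1 q t) := by
        rw [decay_mul, one_mul]
        refine (le_abs_self _).trans (h2.trans_eq ?_)
        rw [Real.norm_of_nonneg (decay_nonneg zero_le_one _ _)]
      have h6 : (1 - decay c τ t) * r t ≤ (1 - decay c τ t) * (M * decay 1 q t) :=
        mul_le_mul_of_nonneg_left ih (by linarith)
      have h7 := mul_le_mul_of_nonneg_left (decay_succ_ge q t) hM0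
      have hA := decay_nonneg zero_le_one τ t
      have hB := decay_nonneg zero_le_one q t
      rw [decay_eq_mul] at h3
      have h8 : max q 0 / ((t : ℝ) + 1) * (M * decay 1 q t) ≤
          (c - c') * decay 1 τ t * (M * decay 1 q t) :=
        mul_le_mul_of_nonneg_right h3 (mul_nonneg hM0 hB)
      have h9 : C * (decay 1 τ t * decay 1 q t) ≤ M * c' * (decay 1 τ t * decay 1 q t) :=
        mul_le_mul_of_nonneg_right hM (mul_nonneg hA hB)
      rw [decay_eq_mul] at h6 h1
      linarith
  refine IsBigO.of_bound M (eventually_atTop.2 ⟨T, fun t ht => ?_⟩)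
  rw [Real.norm_of_nonneg (hr t), Real.norm_of_nonneg (decay_nonneg zero_le_one _ _)]
  exact key t ht

theorem tendsto_rpow_mul_of_isBigO_decay {X : Type*} [NormedAddCommGroup X] {f : ℕ → X}
    {τ σ : ℝ} (hf : f =O[atTop] decay 1 σ) (h : τ < σ) :
    Tendsto (fun t : ℕ => ((t : ℝ) + 1) ^ τ * ‖f t‖) atTop (𝓝 0) := by
  have h1 : (fun t : ℕ => decay 1 (-τ) t * ‖f t‖) =O[atTop] decay 1 (σ - τ) :=
    isBigO_decay_smul (X := ℝ) 1 hf.norm_left (by linarith)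
  have h2 := h1.trans_tendsto (tendsto_decay 1 (sub_pos.2 h))
  refine h2.congr fun t => ?_
  have hs : (0 : ℝ) < (t : ℝ) + 1 := by positivity
  simp [decay, Real.rpow_neg hs.le]

/-! ### Contraction from coercivity -/

/-- Expanding the square gives `‖x - y‖² ≤ (1 - 2ξ) ‖x‖² ≤ (1 - ξ)² ‖x‖²`. The parameter `κ`
measures the loss to the quadratic term: `κ = 1` halves the rate, small `κ` nearly preserves it, as
the sharp condition on `a` requires. -/
theorem norm_sub_le_of_inner {E : Type*} [NormedAddCommGroup E] [InnerProductSpace ℝ E]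
    {x y : E} {μ κ : ℝ} (hκ : κ ≤ 2) (h1 : μ * ‖x‖ ^ 2 ≤ inner ℝ x y)
    (h2 : ‖y‖ ^ 2 ≤ κ * inner ℝ x y) : ‖x - y‖ ≤ (1 - (1 - κ / 2) * μ) * ‖x‖ := by
  set ξ := (1 - κ / 2) * μ
  have h3 : ‖x - y‖ ^ 2 ≤ (1 - 2 * ξ) * ‖x‖ ^ 2 := by
    rw [norm_sub_sq_real]
    have := mul_le_mul_of_nonneg_left h1 (by linarith : 0 ≤ 2 - κ)
    simp only [ξ]
    linarith
  rcases (norm_nonneg x).eq_or_lt with h0 | h0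
  · rw [← h0] at h3 ⊢
    have : ‖x - y‖ = 0 := by
      have := sq_nonneg ‖x - y‖
      exact pow_eq_zero_iff two_ne_zero |>.1 (by linarith)
    simp [this]
  · have h4 : 0 ≤ 1 - 2 * ξ :=
      nonneg_of_mul_nonneg_left ((sq_nonneg _).trans h3) (by positivity)
    refine abs_le_of_sq_le_sq' (h3.trans ?_) (mul_nonneg (by linarith) h0.le) |>.2
    rw [mul_pow]
    gcongr
    linarith [sq_nonneg ξ]

/-- A continuous, positive, 2-homogeneous function dominates a multiple of the squared norm. -/
theorem exists_coercive {E : Type*} [NormedAddCommGroup E] [NormedSpace ℝ E]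
    [FiniteDimensional ℝ E] {f : E → ℝ} (hf : Continuous f)
    (hhom : ∀ (k : ℝ) x, f (k • x) = k ^ 2 * f x) (hpos : ∀ x, x ≠ 0 → 0 < f x) :
    ∃ c > 0, ∀ x, c * ‖x‖ ^ 2 ≤ f x := by
  have := FiniteDimensional.proper_real E
  have h0 : f 0 = 0 := by simpa using hhom 0 0
  rcases subsingleton_or_nontrivial E with hE | hE
  · exact ⟨1, one_pos, fun x => by simp [Subsingleton.elim x 0, h0]⟩
  obtain ⟨y, hy, hmin⟩ := (isCompact_sphere (0 : E) 1).exists_isMinOn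
    ((NormedSpace.sphere_nonempty).2 zero_le_one) hf.continuousOn
  have hy0 : y ≠ 0 := by
    rintro rfl
    simp at hy
  refine ⟨f y, hpos y hy0, fun x => ?_⟩
  rcases eq_or_ne x 0 with rfl | hx
  · simp [h0]
  have hx' : ‖x‖ ≠ 0 := norm_ne_zero_iff.2 hx
  have h1 : f y ≤ f (‖x‖⁻¹ • x) := hmin (by simp [norm_smul, hx'])
  rw [hhom] at h1
  calc f y * ‖x‖ ^ 2 ≤ ‖x‖⁻¹ ^ 2 * f x * ‖x‖ ^ 2 := by gcongr
    _ = f x := by field_simp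

/-! ### Laplacian, averaging and block diagonal operators -/

noncomputable section

variable {ι X : Type*} [Fintype ι] [NormedAddCommGroup X] [InnerProductSpace ℝ X]

/-- The graph Laplacian acting on families of vectors. -/
def laplacian (Gr : SimpleGraph ι) [DecidableRel Gr.Adj] :
    PiLp 2 (fun _ : ι => X) →ₗ[ℝ] PiLp 2 (fun _ : ι => X) where
  toFun z := WithLp.toLp 2 fun i => ∑ j ∈ Gr.neighborFinset i, (z i - z j)
  map_add' z w := by
    ext i
    simp only [PiLp.add_apply, ← Finset.sum_add_distrib]
    exact Finset.sum_congr rfl fun j _ => by abel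
  map_smul' k z := by
    ext i
    simp only [PiLp.smul_apply, Finset.smul_sum, smul_sub, RingHom.id_apply]

/-- The block diagonal operator with blocks `T i`. -/
def blockDiag (T : ι → X →ₗ[ℝ] X) :
    PiLp 2 (fun _ : ι => X) →ₗ[ℝ] PiLp 2 (fun _ : ι => X) where
  toFun z := WithLp.toLp 2 fun i => T i (z i)
  map_add' z w := by ext i; simp
  map_smul' k z := by ext i; simp

/-- The average of a family of vectors. -/
def average : PiLp 2 (fun _ : ι => X) →ₗ[ℝ] X where
  toFun z := (Fintype.card ι : ℝ)⁻¹ • ∑ i, z i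
  map_add' z w := by simp [Finset.sum_add_distrib]
  map_smul' k z := by
    simp only [PiLp.smul_apply, ← Finset.smul_sum, RingHom.id_apply]
    rw [smul_comm]

/-- The constant family. -/
def constant : X →ₗ[ℝ] PiLp 2 (fun _ : ι => X) where
  toFun d := WithLp.toLp 2 fun _ => d
  map_add' _ _ := rfl
  map_smul' _ _ := rfl

/-- The deviation of a family from its average. -/
def deviation : PiLp 2 (fun _ : ι => X) →ₗ[ℝ] PiLp 2 (fun _ : ι => X) :=
  LinearMap.id - constant ∘ₗ average

variable (Gr : SimpleGraph ι) [DecidableRel Gr.Adj]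

@[simp]
theorem laplacian_apply (z : PiLp 2 (fun _ : ι => X)) (i : ι) :
    laplacian Gr z i = ∑ j ∈ Gr.neighborFinset i, (z i - z j) := rfl

omit [Fintype ι] in
@[simp]
theorem blockDiag_apply (T : ι → X →ₗ[ℝ] X) (z : PiLp 2 (fun _ : ι => X)) (i : ι) :
    blockDiag T z i = T i (z i) := rfl

omit [Fintype ι] in
@[simp]
theorem constant_apply (d : X) (i : ι) : constant (ι := ι) d i = d := rfl

theorem average_apply (z : PiLp 2 (fun _ : ι => X)) :
    average z = (Fintype.card ι : ℝ)⁻¹ • ∑ i, z i := rfl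

theorem deviation_apply (z : PiLp 2 (fun _ : ι => X)) :
    deviation z = z - constant (average z) := rfl

theorem average_constant [Nonempty ι] (d : X) : average (constant (ι := ι) d) = d := by
  simp [average_apply, ← Nat.cast_smul_eq_nsmul ℝ, smul_smul]

theorem average_deviation [Nonempty ι] (z : PiLp 2 (fun _ : ι => X)) :
    average (deviation z) = 0 := by
  rw [deviation_apply, map_sub, average_constant, sub_self]

theorem laplacian_constant (d : X) : laplacian Gr (constant (ι := ι) d) = 0 := by
  ext i; simp

theorem sum_neighborFinset_comm {M : Type*} [AddCommMonoid M] (f : ι → ι → M) :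
    ∑ i, ∑ j ∈ Gr.neighborFinset i, f i j = ∑ i, ∑ j ∈ Gr.neighborFinset i, f j i :=
  Finset.sum_comm' fun i j => by simp [Gr.adj_comm]

/-- By symmetry of adjacency the double sum of differences equals its own negative, so consensus
terms do not move the average. -/
theorem average_laplacian (z : PiLp 2 (fun _ : ι => X)) : average (laplacian Gr z) = 0 := by
  have h : ∑ i, laplacian Gr z i = -∑ i, laplacian Gr z i := by
    simp only [laplacian_apply]
    conv_lhs => rw [sum_neighborFinset_comm]
    simp only [← Finset.sum_neg_distrib, neg_sub]
  rw [← add_eq_zero_iff_eq_neg, ← two_smul ℝ] at h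
  rw [average_apply, (smul_eq_zero.1 h).resolve_left two_ne_zero, smul_zero]

theorem deviation_laplacian (z : PiLp 2 (fun _ : ι => X)) :
    deviation (laplacian Gr z) = laplacian Gr (deviation z) := by
  rw [deviation_apply, average_laplacian, deviation_apply, map_sub, laplacian_constant]
  simp

/-- Symmetrization: the double sum is added to its copy with `i` and `j` exchanged. Each edge is
counted twice, hence the factor 2. -/
theorem inner_laplacian (z : PiLp 2 (fun _ : ι => X)) :
    2 * inner ℝ z (laplacian Gr z) = ∑ i, ∑ j ∈ Gr.neighborFinset i, ‖z i - z j‖ ^ 2 := by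
  have h1 : inner ℝ z (laplacian Gr z) =
      ∑ i, ∑ j ∈ Gr.neighborFinset i, inner ℝ (z i) (z i - z j) := by
    simp only [PiLp.inner_apply, laplacian_apply, inner_sum]
  have h2 := h1
  rw [sum_neighborFinset_comm] at h2
  rw [two_mul]
  nth_rw 1 [h1]
  rw [h2]
  simp only [← Finset.sum_add_distrib]
  refine Finset.sum_congr rfl fun i _ => Finset.sum_congr rfl fun j _ => ?_
  rw [← real_inner_self_eq_norm_sq, inner_sub_left, ← neg_sub (z i) (z j), inner_neg_right]
  ring

theorem inner_laplacian_nonneg (z : PiLp 2 (fun _ : ι => X)) :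
    0 ≤ inner ℝ z (laplacian Gr z) := by
  have h := inner_laplacian Gr z
  have : 0 ≤ ∑ i, ∑ j ∈ Gr.neighborFinset i, ‖z i - z j‖ ^ 2 := by positivity
  linarith

/-- Cauchy–Schwarz at each node, with degrees bounded by the number of nodes; this replaces a bound
on the largest eigenvalue. -/
theorem norm_laplacian_sq_le (z : PiLp 2 (fun _ : ι => X)) :
    ‖laplacian Gr z‖ ^ 2 ≤ 2 * Fintype.card ι * inner ℝ z (laplacian Gr z) := by
  rw [mul_comm (2 : ℝ), mul_assoc, inner_laplacian, PiLp.norm_sq_eq_of_L2, Finset.mul_sum]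
  refine Finset.sum_le_sum fun i _ => ?_
  rw [laplacian_apply]
  calc ‖∑ j ∈ Gr.neighborFinset i, (z i - z j)‖ ^ 2
      ≤ (∑ j ∈ Gr.neighborFinset i, ‖z i - z j‖) ^ 2 := by gcongr; exact norm_sum_le _ _
    _ ≤ (Gr.neighborFinset i).card * ∑ j ∈ Gr.neighborFinset i, ‖z i - z j‖ ^ 2 :=
      sq_sum_le_card_mul_sum_sq
    _ ≤ _ := by gcongr; exact Finset.card_le_univ _

/-- Zero energy forces equality across every edge, hence along walks. -/
theorem eq_of_inner_laplacian_eq_zero (hGr : Gr.Connected) {z : PiLp 2 (fun _ : ι => X)}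
    (h : inner ℝ z (laplacian Gr z) = 0) (i j : ι) : z i = z j := by
  have h1 := inner_laplacian Gr z
  rw [h, mul_zero, eq_comm, Finset.sum_eq_zero_iff_of_nonneg fun _ _ => by positivity] at h1
  have hadj : ∀ i j, Gr.Adj i j → z i = z j := by
    intro i j hij
    have h2 := h1 i (Finset.mem_univ i)
    rw [Finset.sum_eq_zero_iff_of_nonneg fun _ _ => by positivity] at h2
    have h3 := h2 j (by simpa using hij)
    exact sub_eq_zero.1 (norm_eq_zero.1 (pow_eq_zero_iff two_ne_zero |>.1 h3))
  obtain ⟨w⟩ := hGr.preconnected i j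
  induction w with
  | nil => rfl
  | cons hd _ ih => exact (hadj _ _ hd).trans ih

theorem inner_blockDiag (T : ι → X →ₗ[ℝ] X) (z : PiLp 2 (fun _ : ι => X)) :
    inner ℝ z (blockDiag T z) = ∑ i, inner ℝ (z i) (T i (z i)) := by
  simp [PiLp.inner_apply]

theorem norm_blockDiag_sq_le {T : ι → X →ₗ[ℝ] X} {K : ℝ}
    (hK : ∀ i x, ‖T i x‖ ^ 2 ≤ K * inner ℝ x (T i x)) (z : PiLp 2 (fun _ : ι => X)) :
    ‖blockDiag T z‖ ^ 2 ≤ K * inner ℝ z (blockDiag T z) := by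
  rw [inner_blockDiag, PiLp.norm_sq_eq_of_L2, Finset.mul_sum]
  exact Finset.sum_le_sum fun i _ => hK i (z i)

theorem norm_sum_sq_le {T : ι → X →ₗ[ℝ] X} {K : ℝ}
    (hK : ∀ i x, ‖T i x‖ ^ 2 ≤ K * inner ℝ x (T i x)) (x : X) :
    ‖∑ i, T i x‖ ^ 2 ≤ Fintype.card ι * K * inner ℝ x (∑ i, T i x) := by
  calc ‖∑ i, T i x‖ ^ 2 ≤ (∑ i, ‖T i x‖) ^ 2 := by gcongr; exact norm_sum_le _ _
    _ ≤ Fintype.card ι * ∑ i, ‖T i x‖ ^ 2 := sq_sum_le_card_mul_sum_sq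
    _ ≤ Fintype.card ι * ∑ i, K * inner ℝ x (T i x) := by
      gcongr with i _; exact hK i x
    _ = _ := by rw [inner_sum, ← Finset.mul_sum, mul_assoc]

variable [FiniteDimensional ℝ X]

/-- The Laplacian form vanishes only on consensus families, where the block form reduces to that of
`∑ i, T i`, which is positive. -/
theorem exists_coercive_laplacian_add_blockDiag (hGr : Gr.Connected) {T : ι → X →ₗ[ℝ] X}
    (hT : ∀ i x, 0 ≤ inner ℝ x (T i x)) (hpos : ∀ x, x ≠ 0 → 0 < inner ℝ x (∑ i, T i x))
    {k : ℝ} (hk : 0 < k) :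
    ∃ c > 0, ∀ z : PiLp 2 (fun _ : ι => X),
      c * ‖z‖ ^ 2 ≤ k * inner ℝ z (laplacian Gr z) + inner ℝ z (blockDiag T z) := by
  have hL := (laplacian (X := X) Gr).continuous_of_finiteDimensional
  have hD := (blockDiag T).continuous_of_finiteDimensional
  refine exists_coercive (by fun_prop) (fun r z => ?_) fun z hz => ?_
  · simp only [map_smul, real_inner_smul_left, real_inner_smul_right]; ring
  · have h1 := inner_laplacian_nonneg Gr z
    have h2 : 0 ≤ inner ℝ z (blockDiag T z) := by
      rw [inner_blockDiag]; exact Finset.sum_nonneg fun i _ => hT i _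
    rcases h1.eq_or_lt with h0 | h0
    · have hcons := eq_of_inner_laplacian_eq_zero Gr hGr h0.symm
      obtain ⟨i⟩ := hGr.nonempty
      have hzi : z i ≠ 0 := by
        intro h
        refine hz (PiLp.ext fun j => ?_)
        rw [hcons j i, h]; rfl
      have : inner ℝ z (blockDiag T z) = inner ℝ (z i) (∑ j, T j (z i)) := by
        rw [inner_blockDiag, inner_sum]
        exact Finset.sum_congr rfl fun j _ => by rw [hcons j i]
      rw [this, ← h0]
      simpa using hpos _ hzi
    · have := mul_pos hk h0
      linarith

/-- Adding `‖average z‖²` makes the Laplacian form positive definite, and the added term vanishes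
when the average is zero. -/
theorem exists_coercive_laplacian (hGr : Gr.Connected) :
    ∃ c > 0, ∀ z : PiLp 2 (fun _ : ι => X), average z = 0 →
      c * ‖z‖ ^ 2 ≤ inner ℝ z (laplacian Gr z) := by
  have hL := (laplacian (X := X) Gr).continuous_of_finiteDimensional
  have hA := (average (ι := ι) (X := X)).continuous_of_finiteDimensional
  have hne := hGr.nonempty
  obtain ⟨c, hc, h⟩ := exists_coercive
    (f := fun z : PiLp 2 (fun _ : ι => X) => inner ℝ z (laplacian Gr z) + ‖average z‖ ^ 2)
    (by fun_prop) (fun r z => by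
      simp only [map_smul, real_inner_smul_left, real_inner_smul_right, norm_smul, mul_pow,
        Real.norm_eq_abs, sq_abs]
      ring) fun z hz => by
      have h1 := inner_laplacian_nonneg Gr z
      rcases h1.eq_or_lt with h0 | h0
      · have hcons := eq_of_inner_laplacian_eq_zero Gr hGr h0.symm
        obtain ⟨i⟩ := id hne
        have hz' : z = constant (z i) := PiLp.ext fun j => hcons j i
        have : average z ≠ 0 := by
          intro h
          rw [hz', average_constant] at h
          rw [h, map_zero] at hz'
          exact hz hz'
        rw [← h0]
        positivity
      · positivity
  refine ⟨c, hc, fun z hz => ?_⟩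
  simpa [hz] using h z

theorem isBigO_linearMap {E F : Type*} [NormedAddCommGroup E] [NormedSpace ℝ E]
    [FiniteDimensional ℝ E] [NormedAddCommGroup F] [NormedSpace ℝ F] (A : E →ₗ[ℝ] F)
    {f : ℕ → E} {g : ℕ → ℝ} (hf : f =O[atTop] g) : (fun t => A (f t)) =O[atTop] g :=
  ((LinearMap.toContinuousLinearMap A).isBigO_comp f atTop).trans hf

/-! ### Pathwise rates for the networked recursion -/

variable {z ν η : ℕ → PiLp 2 (fun _ : ι => X)} {T : ι → X →ₗ[ℝ] X} {a b τ₁ τ₂ ρ p K : ℝ}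

/-- Growth of the estimation errors under noises of order `(t + 1) ^ p`. -/
theorem isBigO_error (hGr : Gr.Connected)
    (hT : ∀ i x, 0 ≤ inner ℝ x (T i x)) (hK : ∀ i x, ‖T i x‖ ^ 2 ≤ K * inner ℝ x (T i x))
    (hpos : ∀ x, x ≠ 0 → 0 < inner ℝ x (∑ i, T i x))
    (ha : 0 < a) (hb : 0 < b) (hτ₂ : 0 < τ₂) (hτ₂₁ : τ₂ ≤ τ₁) (hτ₁ : τ₁ ≤ 1)
    (hp : 0 ≤ p) (hρ : τ₁ ≤ τ₂ + ρ)
    (hν : ν =O[atTop] decay 1 (-p)) (hη : η =O[atTop] decay 1 ρ)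
    (hz : ∀ t, z (t + 1) = z t - (decay b τ₂ t • laplacian Gr (z t)
      + decay a τ₁ t • blockDiag T (z t)) + (decay a τ₁ t • ν t + decay b τ₂ t • η t)) :
    z =O[atTop] decay 1 (-p) := by
  obtain ⟨c, hc, hcoer⟩ := exists_coercive_laplacian_add_blockDiag Gr hGr hT hpos (div_pos hb ha)
  have hτ₁0 : 0 < τ₁ := hτ₂.trans_le hτ₂₁
  have hforce : (fun t => ‖decay a τ₁ t • ν t + decay b τ₂ t • η t‖) =O[atTop]
      decay 1 (τ₁ + -p) :=
    ((isBigO_decay_smul a hν le_rfl).add (isBigO_decay_smul b hη (by linarith))).norm_left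
  -- The target exponent `-p` is nonpositive, so any positive rate suffices even when `τ₁ = 1`.
  refine isBigO_norm_left.1 (isBigO_decay_of_recursion (c := a * c / 2) (fun t => norm_nonneg _)
    hτ₁0 hτ₁ (by positivity) (fun _ => lt_of_le_of_lt (neg_nonpos.2 hp) (by positivity)) hforce ?_)
  -- The 4 is the 2 from `‖u + v‖² ≤ 2‖u‖² + 2‖v‖²` times the 2 in `norm_laplacian_sq_le`.
  have e1 : ∀ᶠ t in atTop, decay (b * (4 * Fintype.card ι)) τ₂ t ≤ 1 :=
    (tendsto_decay _ hτ₂).eventually (ge_mem_nhds one_pos)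
  have e2 : ∀ᶠ t in atTop, decay (a * (2 * K)) τ₁ t ≤ 1 :=
    (tendsto_decay _ hτ₁0).eventually (ge_mem_nhds one_pos)
  filter_upwards [e1, e2] with t h1 h2
  rw [hz]
  refine (norm_add_le _ _).trans (add_le_add_left ?_ _)
  set α := decay a τ₁ t with hα_def
  set β := decay b τ₂ t with hβ_def
  set L := laplacian Gr (z t)
  set D := blockDiag T (z t)
  have hα : 0 ≤ α := decay_nonneg ha.le _ _
  have hβ : 0 ≤ β := decay_nonneg hb.le _ _
  have h1' : β * (4 * Fintype.card ι) ≤ 1 := by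
    refine le_trans (le_of_eq ?_) h1
    rw [hβ_def, decay_eq_mul, decay_eq_mul (b * _)]; ring
  have h2' : α * (2 * K) ≤ 1 := by
    refine le_trans (le_of_eq ?_) h2
    rw [hα_def, decay_eq_mul, decay_eq_mul (a * _)]; ring
  -- As `τ₂ ≤ τ₁`, the form of `β L + α D` dominates `α` times that of `(b / a) L + D`.
  have hαβ : b / a * α ≤ β := by
    rw [hα_def, hβ_def, decay_eq_mul, decay_eq_mul b, ← mul_assoc, div_mul_cancel₀ _ ha.ne']
    have := decay_anti hτ₂₁ t
    gcongr
  have hL0 : 0 ≤ inner ℝ (z t) L := inner_laplacian_nonneg Gr (z t)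
  have hD0 : 0 ≤ inner ℝ (z t) D := by
    simp only [D, inner_blockDiag]; exact Finset.sum_nonneg fun i _ => hT i _
  have hLn : ‖L‖ ^ 2 ≤ 2 * Fintype.card ι * inner ℝ (z t) L := norm_laplacian_sq_le Gr (z t)
  have hDn : ‖D‖ ^ 2 ≤ K * inner ℝ (z t) D := norm_blockDiag_sq_le hK (z t)
  have hin : inner ℝ (z t) (β • L + α • D) = β * inner ℝ (z t) L + α * inner ℝ (z t) D := by
    rw [inner_add_right, real_inner_smul_right, real_inner_smul_right]
  have key := norm_sub_le_of_inner (x := z t) (y := β • L + α • D) (μ := α * c) (κ := 1)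
    one_le_two ?_ ?_
  · refine key.trans_eq ?_
    have : decay (a * c / 2) τ₁ t = (1 - 1 / 2) * (α * c) := by
      rw [hα_def, decay_eq_mul, decay_eq_mul a]; ring
    rw [this]
  · rw [hin]
    have g1 := mul_le_mul_of_nonneg_left (hcoer (z t)) hα
    have g2 := mul_le_mul_of_nonneg_right hαβ hL0
    linarith
  · rw [hin, one_mul]
    have g1 : ‖β • L + α • D‖ ^ 2 ≤ 2 * (β ^ 2 * ‖L‖ ^ 2) + 2 * (α ^ 2 * ‖D‖ ^ 2) := by
      have := parallelogram_law_with_norm ℝ (β • L) (α • D)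
      have e1 : ‖β • L‖ = β * ‖L‖ := by rw [norm_smul, Real.norm_of_nonneg hβ]
      have e2 : ‖α • D‖ = α * ‖D‖ := by rw [norm_smul, Real.norm_of_nonneg hα]
      rw [e1, e2] at this
      linarith [mul_self_nonneg ‖β • L - α • D‖]
    have g2 := mul_le_mul_of_nonneg_left hLn (sq_nonneg β)
    have g3 := mul_le_mul_of_nonneg_left hDn (sq_nonneg α)
    have g4 := mul_le_mul_of_nonneg_right h1' (mul_nonneg hβ hL0)
    have g5 := mul_le_mul_of_nonneg_right h2' (mul_nonneg hα hD0)
    linarith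

/-- Decay of the disagreement between the agents. -/
theorem isBigO_deviation (hGr : Gr.Connected)
    (hb : 0 < b) (hτ₂ : 0 < τ₂) (hτ₂' : τ₂ < 1) (hρ : τ₁ ≤ τ₂ + ρ) (hp : 0 ≤ p)
    (hν : ν =O[atTop] decay 1 (-p)) (hη : η =O[atTop] decay 1 ρ)
    (hzO : z =O[atTop] decay 1 (-p))
    (hz : ∀ t, z (t + 1) = z t - (decay b τ₂ t • laplacian Gr (z t)
      + decay a τ₁ t • blockDiag T (z t)) + (decay a τ₁ t • ν t + decay b τ₂ t • η t)) :
    (fun t => deviation (z t)) =O[atTop] decay 1 (τ₁ - τ₂ - p) := by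
  obtain ⟨c, hc, hcoer⟩ := exists_coercive_laplacian (X := X) Gr hGr
  have hne := hGr.nonempty
  -- The innovation and noise are treated as forcing of order `τ₁ - p`; contraction at order `τ₂`
  -- then gains `τ₁ - τ₂ - p`.
  have hforce : (fun t => ‖deviation (decay a τ₁ t • (ν t - blockDiag T (z t)) +
      decay b τ₂ t • η t)‖) =O[atTop] decay 1 (τ₂ + (τ₁ - τ₂ - p)) :=
    (isBigO_linearMap deviation
      ((isBigO_decay_smul a (hν.sub (isBigO_linearMap (blockDiag T) hzO)) (by linarith)).add
        (isBigO_decay_smul b hη (by linarith)))).norm_left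
  refine isBigO_norm_left.1 (isBigO_decay_of_recursion (c := b * c / 2) (fun t => norm_nonneg _)
    hτ₂ hτ₂'.le (by positivity) (fun h => absurd h hτ₂'.ne) hforce ?_)
  have e1 : ∀ᶠ t in atTop, decay (b * (2 * Fintype.card ι)) τ₂ t ≤ 1 :=
    (tendsto_decay _ hτ₂).eventually (ge_mem_nhds one_pos)
  filter_upwards [e1] with t h1
  have hβ : 0 ≤ decay b τ₂ t := decay_nonneg hb.le _ _
  have h1' : decay b τ₂ t * (2 * Fintype.card ι) ≤ 1 := by
    refine le_trans (le_of_eq ?_) h1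
    rw [decay_eq_mul, decay_eq_mul (b * _)]; ring
  have hstep : deviation (z (t + 1)) =
      deviation (z t) - decay b τ₂ t • laplacian Gr (deviation (z t)) +
      deviation (decay a τ₁ t • (ν t - blockDiag T (z t)) + decay b τ₂ t • η t) := by
    rw [← deviation_laplacian, ← map_smul, ← map_sub, ← map_add, hz]
    congr 1
    module
  rw [hstep]
  refine (norm_add_le _ _).trans (add_le_add_left ?_ _)
  set β := decay b τ₂ t with hβ_def
  set d := deviation (z t)
  have g1 := hcoer d (average_deviation _)
  have g2 := norm_laplacian_sq_le Gr d
  have g3 := inner_laplacian_nonneg Gr d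
  have key := norm_sub_le_of_inner (x := d) (y := β • laplacian Gr d) (μ := β * c) (κ := 1)
    one_le_two ?_ ?_
  · refine key.trans_eq ?_
    have : decay (b * c / 2) τ₂ t = (1 - 1 / 2) * (β * c) := by
      rw [hβ_def, decay_eq_mul, decay_eq_mul b]; ring
    rw [this]
  · rw [real_inner_smul_right, mul_assoc]
    gcongr
  · rw [real_inner_smul_right, norm_smul, Real.norm_of_nonneg hβ, mul_pow]
    have g4 := mul_le_mul_of_nonneg_left g2 (sq_nonneg β)
    have g5 := mul_le_mul_of_nonneg_right h1' (mul_nonneg hβ g3)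
    linarith

/-- Decay of the difference between the average of the agents and the centralized recursion. -/
theorem isBigO_average_sub {w : ℕ → X} {q lam : ℝ} (hne : Nonempty ι) (hlam : 0 < lam)
    (hcoer : ∀ x, lam * ‖x‖ ^ 2 ≤ inner ℝ x (∑ i, T i x))
    (hK : ∀ i x, ‖T i x‖ ^ 2 ≤ K * inner ℝ x (T i x))
    (ha : 0 < a) (hτ₁0 : 0 < τ₁) (hτ₁ : τ₁ ≤ 1) (hq : τ₁ + q ≤ τ₂ + ρ)
    (hq1 : τ₁ = 1 → q < a * lam / Fintype.card ι)
    (hη : η =O[atTop] decay 1 ρ)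
    (hdev : (fun t => deviation (z t)) =O[atTop] decay 1 q)
    (hz : ∀ t, z (t + 1) = z t - (decay b τ₂ t • laplacian Gr (z t)
      + decay a τ₁ t • blockDiag T (z t)) + (decay a τ₁ t • ν t + decay b τ₂ t • η t))
    (hw : ∀ t, w (t + 1) = w t - decay a τ₁ t • average (blockDiag T (constant (w t)))
      + decay a τ₁ t • average (ν t)) :
    (fun t => average (z t) - w t) =O[atTop] decay 1 q := by
  set M : ℝ := (Fintype.card ι : ℝ)
  have hM : 0 < M := by simp only [M]; exact_mod_cast Fintype.card_pos
  have hrate : 0 < a * lam / M := by positivity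
  -- The gap between `c` and the ideal rate `a * lam / M` absorbs the quadratic term through `κ = 2
  -- * (1 - c / (a * lam / M))`, so that `(1 - κ / 2) * (α / M * lam)` is exactly `decay c τ₁ t`.
  obtain ⟨c, hc, hc1, hcq⟩ : ∃ c, 0 < c ∧ c < a * lam / M ∧ (τ₁ = 1 → q < c) := by
    by_cases h : τ₁ = 1
    · obtain ⟨c, h1, h2⟩ := exists_between (max_lt (hq1 h) hrate)
      exact ⟨c, (le_max_right _ _).trans_lt h1, h2, fun _ => (le_max_left _ _).trans_lt h1⟩
    · exact ⟨a * lam / M / 2, by positivity, half_lt_self hrate, fun h' => absurd h' h⟩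
  have hforce : (fun t => ‖decay a τ₁ t • (-average (blockDiag T (deviation (z t)))) +
      decay b τ₂ t • average (η t)‖) =O[atTop] decay 1 (τ₁ + q) :=
    ((isBigO_decay_smul a
      (isBigO_linearMap average (isBigO_linearMap (blockDiag T) hdev)).neg_left le_rfl).add
      (isBigO_decay_smul b (isBigO_linearMap average hη) hq)).norm_left
  refine isBigO_norm_left.1 (isBigO_decay_of_recursion (c := c) (fun t => norm_nonneg _)
    hτ₁0 hτ₁ hc hcq hforce ?_)
  have e1 : ∀ᶠ t in atTop, decay (a * K) τ₁ t ≤ 2 * (1 - c / (a * lam / M)) := by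
    refine (tendsto_decay _ hτ₁0).eventually (ge_mem_nhds ?_)
    have := (div_lt_one hrate).2 hc1
    linarith
  filter_upwards [e1] with t h1
  have hα : 0 ≤ decay a τ₁ t := decay_nonneg ha.le _ _
  -- Splitting `z` into its average and deviation; the averaged noises cancel.
  have hstep : average (z (t + 1)) - w (t + 1) =
      (average (z t) - w t) - (decay a τ₁ t / M) • ∑ i, T i (average (z t) - w t) +
      (decay a τ₁ t • (-average (blockDiag T (deviation (z t)))) +
        decay b τ₂ t • average (η t)) := by
    have h2 : (decay a τ₁ t / M) • ∑ i, T i (average (z t) - w t) =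
        decay a τ₁ t • average (blockDiag T (constant (average (z t) - w t))) := by
      rw [average_apply (blockDiag T _), smul_smul, div_eq_mul_inv]
      rfl
    rw [h2, hz, hw, deviation_apply]
    simp only [map_add, map_sub, map_smul, average_laplacian]
    module
  rw [hstep]
  refine (norm_add_le _ _).trans (add_le_add_left ?_ _)
  have h1' : decay a τ₁ t * K ≤ 2 * (1 - c / (a * lam / M)) := by
    refine le_trans (le_of_eq ?_) h1
    rw [decay_eq_mul, decay_eq_mul (a * _)]; ring
  have hdc : decay c τ₁ t = c / a * decay a τ₁ t := by
    rw [decay_eq_mul, decay_eq_mul a]; field_simp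
  set α := decay a τ₁ t with hα_def
  set d := average (z t) - w t
  have g1 := hcoer d
  have g2 := norm_sum_sq_le hK d
  have g3 : 0 ≤ inner ℝ d (∑ i, T i d) := le_trans (by positivity) g1
  have hαM : 0 ≤ α / M := by positivity
  have hc2 : c / (a * lam / M) ≤ 1 := ((div_lt_one hrate).2 hc1).le
  have hc3 : 0 < c / (a * lam / M) := by positivity
  have key := norm_sub_le_of_inner (x := d) (y := (α / M) • ∑ i, T i d) (μ := α / M * lam)
    (κ := 2 * (1 - c / (a * lam / M))) (by linarith) ?_ ?_
  · refine key.trans_eq ?_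
    rw [hdc]
    congr 2
    field_simp
    ring
  · rw [real_inner_smul_right, mul_assoc]
    gcongr
  · rw [real_inner_smul_right, norm_smul, Real.norm_of_nonneg hαM, mul_pow]
    calc (α / M) ^ 2 * ‖∑ i, T i d‖ ^ 2
        ≤ (α / M) ^ 2 * (M * K * inner ℝ d (∑ i, T i d)) := by gcongr
      _ = (α * K) * (α / M * inner ℝ d (∑ i, T i d)) := by field_simp
      _ ≤ _ := by gcongr

/-- Rate of approximation of the centralized recursion by the networked one, pathwise. -/
theorem tendsto_rpow_mul_norm_sub {w : ℕ → X} {lam τ₀ : ℝ} (hGr : Gr.Connected)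
    (hT : ∀ i x, 0 ≤ inner ℝ x (T i x)) (hK : ∀ i x, ‖T i x‖ ^ 2 ≤ K * inner ℝ x (T i x))
    (hlam : 0 < lam) (hcoer : ∀ x, lam * ‖x‖ ^ 2 ≤ inner ℝ x (∑ i, T i x))
    (ha : 0 < a) (hb : 0 < b) (hτ₂ : 0 < τ₂) (hτ₁ : τ₁ ≤ 1)
    (hp : 0 ≤ p) (hτ₀ : 0 ≤ τ₀) (hτ₀p : τ₀ < τ₁ - τ₂ - p) (hτ₀ρ : τ₀ < ρ + τ₂ - τ₁)
    (hτ₀a : τ₁ = 1 → τ₀ < a * lam / Fintype.card ι)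
    (hν : ν =O[atTop] decay 1 (-p)) (hη : η =O[atTop] decay 1 ρ)
    (hz : ∀ t, z (t + 1) = z t - (decay b τ₂ t • laplacian Gr (z t)
      + decay a τ₁ t • blockDiag T (z t)) + (decay a τ₁ t • ν t + decay b τ₂ t • η t))
    (hw : ∀ t, w (t + 1) = w t - decay a τ₁ t • average (blockDiag T (constant (w t)))
      + decay a τ₁ t • average (ν t)) (i : ι) :
    Tendsto (fun t : ℕ => ((t : ℝ) + 1) ^ τ₀ * ‖z t i - w t‖) atTop (𝓝 0) := by
  have hne := hGr.nonempty
  have hpos : ∀ x, x ≠ 0 → 0 < inner ℝ x (∑ i, T i x) := fun x hx =>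
    lt_of_lt_of_le (by have := norm_pos_iff.2 hx; positivity) (hcoer x)
  -- A rate `q` strictly above `τ₀` turns the final `O` bound into convergence to zero.
  obtain ⟨q, hq0, hqp, hqρ, hqa⟩ : ∃ q, τ₀ < q ∧ q ≤ τ₁ - τ₂ - p ∧ q ≤ ρ + τ₂ - τ₁ ∧
      (τ₁ = 1 → q < a * lam / Fintype.card ι) := by
    have h0 := lt_min hτ₀p hτ₀ρ
    by_cases h : τ₁ = 1
    · obtain ⟨q, h1, h2⟩ := exists_between (lt_min h0 (hτ₀a h))
      obtain ⟨h3, h4⟩ := lt_min_iff.1 h2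
      exact ⟨q, h1, (lt_min_iff.1 h3).1.le, (lt_min_iff.1 h3).2.le, fun _ => h4⟩
    · exact ⟨_, h0, min_le_left _ _, min_le_right _ _, fun h' => absurd h' h⟩
  have hzO := isBigO_error Gr hGr hT hK hpos ha hb hτ₂ (by linarith) hτ₁ hp (by linarith) hν hη hz
  have hdev := (isBigO_deviation Gr hGr hb hτ₂ (by linarith) (by linarith) hp hν hη hzO hz).trans
    (decay_isBigO 1 hqp)
  have havg := isBigO_average_sub Gr hne hlam hcoer hK ha (by linarith) hτ₁ (by linarith) hqa
    hη hdev hz hw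
  have hdev_i : (fun t => deviation (z t) i) =O[atTop] decay 1 q :=
    (IsBigO.of_bound 1 (Eventually.of_forall fun t => by
      rw [one_mul]; exact PiLp.norm_apply_le _ i)).trans hdev
  refine tendsto_rpow_mul_of_isBigO_decay ((hdev_i.add havg).congr_left fun t => ?_) hq0
  rw [deviation_apply, PiLp.sub_apply, constant_apply]
  abel

end

/-! ### Triggering error, observability and noise growth -/

/-- When the event occurs the known value is current; otherwise the event's failure is the bound.
Nothing else about triggering is needed for the rates. -/
theorem norm_known_sub_le {n : ℕ} (ρ : ℝ) (x : ℕ → EuclideanSpace ℝ (Fin n)) (t : ℕ) :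
    ‖known ρ x t - x t‖ ≤ decay 1 ρ t := by
  by_cases h : Event ρ x t
  · simpa [known, gam, h] using decay_nonneg zero_le_one ρ t
  · have h' := not_lt.1 h
    rw [norm_sub_rev] at h'
    simpa [known, gam, h] using h'

/-- The operator `Hᵀ H`. -/
noncomputable def gramOp {m n : ℕ} (H : Matrix (Fin m) (Fin n) ℝ) :
    EuclideanSpace ℝ (Fin n) →ₗ[ℝ] EuclideanSpace ℝ (Fin n) :=
  Matrix.toEuclideanLin H.transpose ∘ₗ Matrix.toEuclideanLin H

theorem inner_gramOp {m n : ℕ} (H : Matrix (Fin m) (Fin n) ℝ) (x : EuclideanSpace ℝ (Fin n)) :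
    inner ℝ x (gramOp H x) = ‖Matrix.toEuclideanLin H x‖ ^ 2 := by
  rw [gramOp, ← Matrix.conjTranspose_eq_transpose_of_trivial,
    Matrix.toEuclideanLin_conjTranspose_eq_adjoint, LinearMap.comp_apply,
    LinearMap.adjoint_inner_right, real_inner_self_eq_norm_sq]

/-- `‖Hᵀ H x‖² ≤ ‖Hᵀ‖² ‖H x‖²`, and `‖H x‖²` is the inner product; summing over agents makes the
constant uniform. -/
theorem exists_norm_gramOp_sq_le {N n : ℕ} {m : Fin N → ℕ}
    (H : (i : Fin N) → Matrix (Fin (m i)) (Fin n) ℝ) :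
    ∃ K, ∀ i x, ‖gramOp (H i) x‖ ^ 2 ≤ K * inner ℝ x (gramOp (H i) x) := by
  set A := fun i => LinearMap.toContinuousLinearMap (Matrix.toEuclideanLin (H i).transpose)
  refine ⟨∑ i, ‖A i‖ ^ 2, fun i x => ?_⟩
  rw [inner_gramOp]
  calc ‖gramOp (H i) x‖ ^ 2 ≤ (‖A i‖ * ‖Matrix.toEuclideanLin (H i) x‖) ^ 2 := by
        gcongr; exact (A i).le_opNorm _
    _ = ‖A i‖ ^ 2 * ‖Matrix.toEuclideanLin (H i) x‖ ^ 2 := mul_pow _ _ _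
    _ ≤ _ := by
        gcongr
        exact Finset.single_le_sum (f := fun i => ‖A i‖ ^ 2) (fun j _ => sq_nonneg _)
          (Finset.mem_univ i)

theorem toEuclideanLin_gramSum {N n : ℕ} {m : Fin N → ℕ}
    (H : (i : Fin N) → Matrix (Fin (m i)) (Fin n) ℝ) (x : EuclideanSpace ℝ (Fin n)) :
    Matrix.toEuclideanLin (gramSum H) x = ∑ i, gramOp (H i) x := by
  simp only [gramSum, map_sum, LinearMap.sum_apply, Matrix.toLpLin_mul_same, gramOp]

theorem posSemidef_gramSum {N n : ℕ} {m : Fin N → ℕ}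
    (H : (i : Fin N) → Matrix (Fin (m i)) (Fin n) ℝ) : (gramSum H).PosSemidef :=
  Matrix.posSemidef_sum _ fun i _ => by
    simpa using Matrix.posSemidef_conjTranspose_mul_self (H i)

/-- The case `n = 0` is excluded since the spectrum is then empty and `sInf ∅ = 0`. -/
theorem lambdaMin_mem_spectrum {n : ℕ} (hn : 0 < n) {A : Matrix (Fin n) (Fin n) ℝ}
    (hA : A.IsHermitian) : lambdaMin A ∈ spectrum ℝ A := by
  refine Set.Nonempty.csInf_mem ?_ A.finite_spectrum
  rw [hA.spectrum_real_eq_range_eigenvalues]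
  exact ⟨_, ⟨0, hn⟩, rfl⟩

theorem lambdaMin_pos {n : ℕ} (hn : 0 < n) {A : Matrix (Fin n) (Fin n) ℝ} (hA : A.PosSemidef)
    (hrank : A.rank = n) : 0 < lambdaMin A := by
  have hmem := lambdaMin_mem_spectrum hn hA.isHermitian
  refine lt_of_le_of_ne
    ((Matrix.posSemidef_iff_isHermitian_and_spectrum_nonneg.1 hA).2 hmem) fun h => ?_
  rw [← h, hA.isHermitian.spectrum_real_eq_range_eigenvalues] at hmem
  obtain ⟨i, hi⟩ := hmem
  have hlt := Fintype.card_subtype_lt (p := fun i => hA.isHermitian.eigenvalues i ≠ 0) (x := i)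
    (not_not.2 hi)
  rw [← hA.isHermitian.rank_eq_card_non_zero_eigs, hrank, Fintype.card_fin] at hlt
  exact lt_irrefl _ hlt

/-- Subtracting `lambdaMin A` times the identity shifts the spectrum into the nonnegative reals. -/
theorem lambdaMin_mul_norm_sq_le {n : ℕ} {A : Matrix (Fin n) (Fin n) ℝ} (hA : A.IsHermitian)
    (x : EuclideanSpace ℝ (Fin n)) :
    lambdaMin A * ‖x‖ ^ 2 ≤ inner ℝ x (Matrix.toEuclideanLin A x) := by
  have hps : (A - lambdaMin A • (1 : Matrix (Fin n) (Fin n) ℝ)).PosSemidef := by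
    refine Matrix.posSemidef_iff_isHermitian_and_spectrum_nonneg.2
      ⟨hA.sub (by simp [Matrix.IsHermitian]), fun r hr => ?_⟩
    rw [← Algebra.algebraMap_eq_smul_one, ← spectrum.sub_singleton_eq] at hr
    obtain ⟨s, hs, _, rfl, rfl⟩ := hr
    exact sub_nonneg.2 (csInf_le A.finite_spectrum.bddBelow hs)
  have h := (Matrix.isPositive_toEuclideanLin_iff.2 hps).re_inner_nonneg_right x
  simp only [map_sub, map_smul, Matrix.toLpLin_one, LinearMap.sub_apply, LinearMap.smul_apply,
    LinearMap.id_apply, inner_sub_right, real_inner_smul_right, real_inner_self_eq_norm_sq,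
    RCLike.re_to_real] at h
  linarith

/-- Identically distributed vectors with a finite moment of order `r` grow at most
like `t ^ (1 / r)`. -/
theorem ae_isBigO_of_identDistrib {Ω E : Type*} [MeasurableSpace Ω] (P : Measure Ω)
    [IsProbabilityMeasure P] [NormedAddCommGroup E] [MeasurableSpace E] [BorelSpace E]
    {V : ℕ → Ω → E} (hident : ∀ t, IdentDistrib (V t) (V 0) P P) {r : ℝ} (hr : 0 < r)
    (hmoment : Integrable (fun ω => ‖V 0 ω‖ ^ r) P) :
    ∀ᵐ ω ∂P, (fun t => V t ω) =O[atTop] decay 1 (-(1 / r)) := by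
  -- Integrability of `‖V 0‖ ^ r` makes its tail probabilities summable, and they depend only on the
  -- common law; Borel–Cantelli follows.
  have hsum : ∑' t : ℕ, P {ω | ‖V t ω‖ ^ r ∈ Set.Ioi (t : ℝ)} ≠ ⊤ := by
    let _ : MeasureSpace Ω := ⟨P⟩
    have : IsProbabilityMeasure (ℙ : Measure Ω) := inferInstanceAs (IsProbabilityMeasure P)
    have h := tsum_prob_mem_Ioi_lt_top (X := fun ω => ‖V 0 ω‖ ^ r) hmoment
      (fun ω => by positivity)
    refine ne_of_lt (lt_of_eq_of_lt (tsum_congr fun t => ?_) h)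
    have hm : Measurable fun e : E => ‖e‖ ^ r := by fun_prop
    exact ((hident t).comp hm).measure_mem_eq measurableSet_Ioi
  filter_upwards [ae_eventually_notMem hsum] with ω hω
  refine IsBigO.of_bound 1 ?_
  filter_upwards [hω] with t ht
  have ht' : ‖V t ω‖ ^ r ≤ (t : ℝ) := not_lt.1 ht
  have hs : (0 : ℝ) < (t : ℝ) + 1 := by positivity
  rw [one_mul, Real.norm_of_nonneg (decay_nonneg zero_le_one _ _)]
  have e : decay 1 (-(1 / r)) t = ((t : ℝ) + 1) ^ (1 / r) := by
    simp [decay, Real.rpow_neg hs.le]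
  rw [e, one_div, Real.le_rpow_inv_iff_of_pos (norm_nonneg _) hs.le hr]
  linarith

theorem isBigO_toLp {ι X : Type*} [Fintype ι] [NormedAddCommGroup X] [NormedSpace ℝ X]
    {f : ℕ → ι → X} {g : ℕ → ℝ} (h : ∀ i, (fun t => f t i) =O[atTop] g) :
    (fun t => (WithLp.toLp 2 (f t) : PiLp 2 fun _ : ι => X)) =O[atTop] g :=
  ((PiLp.continuousLinearEquiv 2 ℝ fun _ : ι => X).symm.toContinuousLinearMap.isBigO_comp
    f atTop).trans (isBigO_pi.2 h)

theorem innovation_eq {m n : ℕ} (H : Matrix (Fin m) (Fin n) ℝ) (θ x : EuclideanSpace ℝ (Fin n))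
    (v : EuclideanSpace ℝ (Fin m)) :
    innovation H (Matrix.toEuclideanLin H θ + v) x =
      Matrix.toEuclideanLin H.transpose v - gramOp H (x - θ) := by
  simp only [innovation, gramOp, LinearMap.comp_apply, map_sub, map_add]
  abel

end EventTriggered

/-! ### The main theorem -/

open EventTriggered in


theorem mainTheorem3 {N n : ℕ} (hN : 0 < N) {m : Fin N → ℕ}
    {Ω : Type*} [MeasurableSpace Ω] (P : Measure Ω) [IsProbabilityMeasure P]
    -- the network
    (Gr : SimpleGraph (Fin N)) [DecidableRel Gr.Adj] (hGr : Gr.Connected)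
    -- the observation model `y i t = H i θ + v i t` and collective observability
    (θ : EuclideanSpace ℝ (Fin n)) (H : (i : Fin N) → Matrix (Fin (m i)) (Fin n) ℝ)
    (hG : (EventTriggered.gramSum H).rank = n)
    (v : (i : Fin N) → ℕ → Ω → EuclideanSpace ℝ (Fin (m i)))
    (y : (i : Fin N) → ℕ → Ω → EuclideanSpace ℝ (Fin (m i)))
    (hy : ∀ i t ω, y i t ω = Matrix.toEuclideanLin (H i) θ + v i t ω)
    -- the stacked noises are i.i.d. in time, centred, with a finite moment of order `2 + ε₁`
    (hindep : iIndepFun (EventTriggered.stack v) P)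
    (hident : ∀ t, IdentDistrib (EventTriggered.stack v t) (EventTriggered.stack v 0) P P)
    (hmean : ∀ i t, ∫ ω, v i t ω ∂P = 0)
    (ε₁ : ℝ) (hε₁ : 0 < ε₁)
    (hmoment : ∀ t, Integrable (fun ω => ‖EventTriggered.stack v t ω‖ ^ (2 + ε₁)) P)
    -- the step sizes and the triggering thresholds
    (a b τ₁ τ₂ : ℝ) (ha : 0 < a) (hb : 0 < b) (hτ₂ : 0 < τ₂) (hτ₂₁ : τ₂ ≤ τ₁) (hτ₁ : τ₁ ≤ 1)
    (hτ : max (τ₂ + 1 / (2 + ε₁)) (1 / 2) < τ₁)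
    (ρ : Fin N → ℝ) (hρ : ∀ i, 0 < ρ i) (hρ₀ : τ₁ - τ₂ < ⨅ i, ρ i)
    -- the event-triggered distributed estimator and the centralized estimator
    (x : Fin N → ℕ → Ω → EuclideanSpace ℝ (Fin n))
    (hx : ∀ ω, EventTriggered.IsDistributedEstimator Gr H ρ
      (EventTriggered.decay a τ₁) (EventTriggered.decay b τ₂)
      (fun i t => y i t ω) (fun i t => x i t ω))
    (u : ℕ → Ω → EuclideanSpace ℝ (Fin n))
    (hu : ∀ ω, EventTriggered.IsCentralizedEstimator H (EventTriggered.decay a τ₁)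
      (fun i t => y i t ω) (fun t => u t ω))
    -- the rate
    (τ₀ : ℝ) (hτ₀ : 0 ≤ τ₀)
    (hτ₀_lt : τ₀ < min (τ₁ - τ₂ - 1 / (2 + ε₁)) ((⨅ i, ρ i) + τ₂ - τ₁))
    (ha_one : τ₁ = 1 → a > N * τ₀ / EventTriggered.lambdaMin (EventTriggered.gramSum H)) :
    ∀ i, ∀ᵐ ω ∂P,
      Tendsto (fun t : ℕ => ((t : ℝ) + 1) ^ τ₀ * ‖x i t ω - u t ω‖) atTop (𝓝 0) := by
  intro i
  have hε : 0 < 2 + ε₁ := by linarith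
  obtain ⟨hτp, hτρ⟩ := lt_min_iff.1 hτ₀_lt
  obtain ⟨K, hK⟩ := exists_norm_gramOp_sq_le H
  -- For `n = 0` all estimates coincide, while `lambdaMin` is not positive.
  rcases Nat.eq_zero_or_pos n with rfl | hn
  · refine Eventually.of_forall fun ω => ?_
    simp [Subsingleton.elim (x i _ ω - u _ ω) 0]
  have hlam := lambdaMin_pos hn (posSemidef_gramSum H) hG
  have hN' : (0 : ℝ) < N := by exact_mod_cast hN
  filter_upwards [ae_isBigO_of_identDistrib P hident hε (hmoment 0)] with ω hω
  have main := tendsto_rpow_mul_norm_sub (X := EuclideanSpace ℝ (Fin n)) Gr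
    (T := fun i => gramOp (H i)) (K := K) (a := a) (b := b) (τ₁ := τ₁) (τ₂ := τ₂)
    (ρ := ⨅ i, ρ i) (p := 1 / (2 + ε₁)) (lam := lambdaMin (gramSum H)) (τ₀ := τ₀)
    (z := fun t => WithLp.toLp 2 fun i => x i t ω - θ)
    (ν := fun t => WithLp.toLp 2 fun i => Matrix.toEuclideanLin (H i).transpose (v i t ω))
    (η := fun t => WithLp.toLp 2 fun i => ∑ j ∈ Gr.neighborFinset i,
      (known (ρ j) (fun t => x j t ω) t - x j t ω))
    (w := fun t => u t ω - θ)
    hGr (fun i x => by rw [inner_gramOp]; positivity) hK hlam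
    (fun x => by
      rw [← toEuclideanLin_gramSum]
      exact lambdaMin_mul_norm_sq_le (posSemidef_gramSum H).isHermitian x)
    ha hb hτ₂ hτ₁ (by positivity) hτ₀ hτp hτρ ?_ ?_ ?_ ?_ ?_ i
  · simpa using main
  · intro h
    have h1 := (div_lt_iff₀ hlam).1 (ha_one h)
    rw [Fintype.card_fin, lt_div_iff₀ hN']
    linarith
  · refine isBigO_toLp fun i => isBigO_linearMap _ (IsBigO.trans ?_ hω)
    refine IsBigO.of_bound 1 (Eventually.of_forall fun t => ?_)
    rw [one_mul]
    exact PiLp.norm_apply_le (stack v t ω) i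
  -- Each threshold exponent is at least the infimum, so every triggering error decays at least at
  -- the common rate.
  · refine isBigO_toLp fun i => IsBigO.fun_sum fun j _ => ?_
    refine IsBigO.of_bound 1 (Eventually.of_forall fun t => ?_)
    rw [one_mul, Real.norm_of_nonneg (decay_nonneg zero_le_one _ _)]
    exact (norm_known_sub_le (ρ j) (fun t => x j t ω) t).trans
      (decay_anti (ciInf_le (Set.finite_range ρ).bddBelow j) t)
  · intro t
    refine PiLp.ext fun i => ?_
    have h := hx ω i t
    simp only [hy, innovation_eq] at h
    simp only [PiLp.add_apply, PiLp.sub_apply, PiLp.smul_apply, laplacian_apply, blockDiag_apply]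
    rw [h]
    -- The consensus term with transmitted values is the triggering error minus the Laplacian of the
    -- errors; `θ` drops out of differences.
    have hs : ∑ j ∈ Gr.neighborFinset i, (known (ρ j) (fun t => x j t ω) t - x i t ω) =
        ∑ j ∈ Gr.neighborFinset i, (known (ρ j) (fun t => x j t ω) t - x j t ω) -
        ∑ j ∈ Gr.neighborFinset i, ((x i t ω - θ) - (x j t ω - θ)) := by
      rw [← Finset.sum_sub_distrib]
      exact Finset.sum_congr rfl fun j _ => by abel
    rw [hs]
    module
  · intro t
    have h := hu ω t
    simp only [hy, innovation_eq, Finset.sum_sub_distrib] at h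
    simp only [average_apply, blockDiag_apply, constant_apply, Fintype.card_fin]
    rw [h]
    module
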